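/- Let $\mathbb{F}$ be a finite field with $k$ elements, and let $\mathcal{L}=\mathbb{F}((X^{-1}))$ be the field of formal Laurent series $\sum_{i=-N}^{\infty} a_{-i}X^{-i}$ ($N\in\mathbb{Z}$, $a_{-i}\in\mathbb{F}$), with the absolute value $|0|=0$ and $\left|\sum_{i=-N}^{\infty} a_{-i}X^{-i}\right|=k^{N}$ when $a_{N}\neq 0$. For $\mathbf{x}\in\mathcal{L}^h$ let $\|\mathbf{x}\|_\infty=\max_i |x_i|$ and let $\langle\mathbf{x}\rangle=\min_{\mathbf{p}\in\mathbb{F}[X]^h}\|\mathbf{x}-\mathbf{p}\|_\infty$. For $m,n\in\mathbb{N}$ identify the $m\times n$ matrices over $\mathcal{L}$ with $\mathcal{L}^{mn}$, with the metric induced by $\|\cdot\|_\infty$, and let $$\mathfrak{B}(m,n)=\left\{A\in\mathcal{L}^{mn} : \exists K>0\ \forall \mathbf{q}\in\mathbb{F}[X]^m\setminus\{0\}\ \ \langle \mathbf{q}A\rangle^n>\frac{K}{\|\mathbf{q}\|_\infty^m}\right\}$$ be the set of badly approximable matrices. Then for all $m,n\in\mathbb{N}$ the Hausdorff dimension of $\mathfrak{B}(m,n)$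 is $mn$. -/

import Mathlib

open scoped Polynomial Matrix

noncomputable section

/-- The field `𝓛 = F((X⁻¹))` of formal Laurent series `∑_{i ≥ -n} a_{-i} X^{-i}` over `F`, realised
as Mathlib's Laurent series in the variable `T = X⁻¹`. It is a separate type so that it can carry
the absolute value normalised by the cardinality of `F`. -/
def InvLaurentSeries (F : Type*) [Field F] : Type _ := LaurentSeries F

namespace InvLaurentSeries

variable {F : Type*} [Field F]

instance : Field (InvLaurentSeries F) := inferInstanceAs (Field (LaurentSeries F))

instance : Algebra F (InvLaurentSeries F) := inferInstanceAs (Algebra F (LaurentSeries F))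

/-- The order of vanishing in `T = X⁻¹`: the least `i` such that the coefficient of `X⁻ⁱ` is
nonzero (and `0` for the zero series). -/
def order (x : InvLaurentSeries F) : ℤ := HahnSeries.order (show LaurentSeries F from x)

open Classical in
/-- The absolute value of `𝓛`, with `k` the number of elements of `F`: a nonzero series with leading
term `a X^n`, which has order `-n` in `X⁻¹`, has absolute value `k ^ n`. -/
def absValue (F : Type*) [Field F] [Finite F] : AbsoluteValue (InvLaurentSeries F) ℝ where
  toFun x := if x = 0 then 0 else (Nat.card F : ℝ) ^ (-x.order)
  map_mul' x y := by
    have hk : (Nat.card F : ℝ) ≠ 0 := by exact_mod_cast Nat.card_pos.ne'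
    by_cases hx : x = 0
    · simp [hx]
    by_cases hy : y = 0
    · simp [hy]
    have h : (x * y).order = x.order + y.order :=
      HahnSeries.order_mul (x := (show LaurentSeries F from x)) (y := y) hx hy
    simp only [mul_eq_zero, hx, hy, or_self, if_false, h]
    rw [neg_add, zpow_add₀ hk]
  nonneg' x := by
    split_ifs <;> positivity
  eq_zero' x := by
    have hk : (Nat.card F : ℝ) ≠ 0 := by exact_mod_cast Nat.card_pos.ne'
    by_cases hx : x = 0
    · simp [hx]
    · simp [hx, zpow_ne_zero _ hk]
  add_le' x y := by
    have hk : (1 : ℝ) ≤ Nat.card F := by exact_mod_cast Nat.card_pos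
    by_cases hx : x = 0
    · simp [hx]
    by_cases hy : y = 0
    · simp [hy]
    by_cases hxy : x + y = 0
    · simp only [hxy, if_true]
      split_ifs <;> positivity
    simp only [hx, hy, hxy, if_false]
    have h : min x.order y.order ≤ (x + y).order :=
      HahnSeries.min_order_le_order_add (x := (show LaurentSeries F from x)) (y := y) hxy
    have hx0 : 0 ≤ (Nat.card F : ℝ) ^ (-x.order) := by positivity
    have hy0 : 0 ≤ (Nat.card F : ℝ) ^ (-y.order) := by positivity
    rcases min_le_iff.mp h with h | h
    · exact (zpow_le_zpow_right₀ hk (neg_le_neg h)).trans (by linarith)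
    · exact (zpow_le_zpow_right₀ hk (neg_le_neg h)).trans (by linarith)

/-- `𝓛` with the absolute value above and the metric `d(x, y) = ‖x - y‖`. -/
instance [Finite F] : NormedField (InvLaurentSeries F) := (absValue F).toNormedField

/-- The element `X` of `𝓛`, that is, `T⁻¹`. -/
def X : InvLaurentSeries F := (HahnSeries.single (-1 : ℤ) (1 : F) : LaurentSeries F)

/-- The inclusion `F[X] → 𝓛` applied to each coordinate of a polynomial vector. -/
def ofPolyVec {h : ℕ} (q : Fin h → F[X]) : Fin h → InvLaurentSeries F :=
  fun i => Polynomial.aeval (X : InvLaurentSeries F) (q i)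

/-- The distance `⟨x⟩` from a vector `x` of `𝓛^h` to the polynomial lattice `F[X]^h`, in the metric
of the height `‖x‖ = max ‖x i‖`. -/
def latticeDist [Finite F] {h : ℕ} (x : Fin h → InvLaurentSeries F) : ℝ :=
  ⨅ p : Fin h → F[X], ‖x - ofPolyVec p‖

end InvLaurentSeries

open InvLaurentSeries

/-- The set `𝔅(m, n)` of badly approximable `m × n` matrices over `𝓛`. -/
def badlyApproximable (F : Type*) [Field F] [Finite F] (m n : ℕ) :
    Set (Matrix (Fin m) (Fin n) (InvLaurentSeries F)) :=
  {A | ∃ K : ℝ, 0 < K ∧ ∀ q : Fin m → F[X], q ≠ 0 →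
    latticeDist (ofPolyVec q ᵥ* A) ^ n > K / ‖ofPolyVec q‖ ^ m}

end

/- Matrices are identified with `𝓛^(mn)`: the metric is that of the maximum of the absolute values
of the entries. -/
attribute [local instance] Matrix.normedAddCommGroup

/-! The upper bound is a covering argument: matrices with poles of order at most `R` are covered by
`k^(mn(R+r))` cylinders of diameter at most `k^(-r)`, and they exhaust the space as `R` grows
(`dimH_matrix_le`).

For the lower bound write `A = ∑ α i X^{-(i+1)}`. The coefficients of `qA` at negative powers of `X`
depend on those of `q` through a block Hankel matrix in the digits `α i`. If its square truncation
of size `mnt` is invertible, a nonzero `q` of degree below `nt` cannot kill the first `mt` of these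
coefficients, so `⟨qA⟩ ≥ k^(-mt)`. Invertibility along an arithmetic progression of `t` thus gives
bad approximability (`digitMatrix_mem_badlyApproximable`).

It remains to count the extensions by `(m+n)N` digits that take level `t` to level `t + N`. If one
fails, a kernel vector `q` of degree `nt + s` with `s < nN` exists. For `s ≤ mt`, the old digits
leave `k^((m+n)s)(k^m - 1)` candidates, and each survives the new digits with probability at most
`k^(-n(mN+s))`. The sum over `s` is `1 - k^(-mnN)`, which gives one good extension
(`HankelNonsingular.exists_extend`) but too few for the dimension. A `q` of minimal degree is not
`X` times a candidate of the previous level; discarding such multiples lowers the failure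
probability to `1 - k^(-(m+n))`, uniformly in `N` (`HankelNonsingular.le_ncard_extend`). The
resulting Cantor set has dimension at least `mn - 1/N` (`le_dimH_of_separated`), and `N` is
arbitrary. -/

/-- A set of functions on a finite type in which every function is determined by its values off `S`
is small. -/
theorem ncard_le_of_determined {F ι : Type*} [Finite F] [Fintype ι] [DecidableEq ι] (P : Set (ι → F))
    (S : Finset ι) (h : ∀ β ∈ P, ∀ β' ∈ P, (∀ i ∉ S, β i = β' i) → β = β') :
    P.ncard ≤ Nat.card F ^ (Fintype.card ι - S.card) := by
  have h1 : Nat.card ({i // i ∉ S} → F) = Nat.card F ^ (Fintype.card ι - S.card) := by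
    rw [Nat.card_fun]
    congr 1
    simp [Nat.card_eq_fintype_card, Fintype.card_subtype_compl]
  rw [← h1, ← Nat.card_coe_set_eq]
  refine Nat.card_le_card_of_injective (fun (β : P) (i : {i // i ∉ S}) => β.1 i) ?_
  intro β β' hβ
  exact Subtype.ext (h _ β.2 _ β'.2 fun i hi => congrFun hβ ⟨i, hi⟩)

/-! ### Block Hankel matrices and their kernels -/

section Hankel

variable {F : Type*} [Field F] {m n : ℕ}

/-- The coefficient of `X^{-(j+1)}` in the product of the polynomial vector `q` with the matrix whose
coefficient of `X^{-(i+1)}` is `α i`. -/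
def hankelOut (α : ℕ → Fin m → Fin n → F) {a : ℕ} (q : Fin a → Fin m → F) (j : ℕ) (c : Fin n) : F :=
  ∑ i : Fin a, ∑ l, q i l * α (i + j) l c

/-- The block Hankel matrix with `b` block columns and `a` block rows, acting on row vectors. -/
def hankelMap (α : ℕ → Fin m → Fin n → F) (a b : ℕ) :
    (Fin a → Fin m → F) →ₗ[F] (Fin b → Fin n → F) where
  toFun q j c := hankelOut α q j c
  map_add' q q' := by
    ext j c
    simp [hankelOut, add_mul, Finset.sum_add_distrib]
  map_smul' r q := by
    ext j c
    simp [hankelOut, mul_assoc, Finset.mul_sum]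

theorem hankelMap_eq_zero_iff {α : ℕ → Fin m → Fin n → F} {a b : ℕ} {q : Fin a → Fin m → F} :
    hankelMap α a b q = 0 ↔ ∀ j < b, ∀ c, hankelOut α q j c = 0 := by
  constructor
  · intro h j hj c
    exact congrFun (congrFun h ⟨j, hj⟩) c
  · intro h
    ext j c
    exact h j j.2 c

/-- The square block Hankel matrix of size `mnt` of `α` is invertible. -/
def HankelNonsingular (α : ℕ → Fin m → Fin n → F) (t : ℕ) : Prop :=
  Function.Injective (hankelMap α (n * t) (m * t))

/-- Prepending a zero is multiplication by `X`, which shifts the coefficients of the product by one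
place. -/
theorem hankelOut_cons (α : ℕ → Fin m → Fin n → F) {a : ℕ} (q : Fin a → Fin m → F) (j : ℕ)
    (c : Fin n) :
    hankelOut α (Fin.cons 0 q : Fin (a + 1) → Fin m → F) j c = hankelOut α q (j + 1) c := by
  simp only [hankelOut, Fin.sum_univ_succ, Fin.cons_zero, Fin.cons_succ, Pi.zero_apply, zero_mul,
    Finset.sum_const_zero, zero_add, Fin.val_succ]
  refine Finset.sum_congr rfl fun i _ => Finset.sum_congr rfl fun l _ => ?_
  rw [show (i : ℕ) + 1 + j = i + (j + 1) by ring]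

theorem hankelOut_snoc (α : ℕ → Fin m → Fin n → F) {a : ℕ} (q : Fin a → Fin m → F) (x : Fin m → F)
    (j : ℕ) (c : Fin n) :
    hankelOut α (Fin.snoc q x : Fin (a + 1) → Fin m → F) j c =
      hankelOut α q j c + ∑ l, x l * α (a + j) l c := by
  simp [hankelOut, Fin.sum_univ_castSucc]

theorem hankelOut_snoc_zero (α : ℕ → Fin m → Fin n → F) {a : ℕ} (q : Fin a → Fin m → F)
    (j : ℕ) (c : Fin n) :
    hankelOut α (Fin.snoc q 0 : Fin (a + 1) → Fin m → F) j c = hankelOut α q j c := by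
  simp [hankelOut_snoc]

theorem hankelOut_congr {α β : ℕ → Fin m → Fin n → F} {a j : ℕ} (h : ∀ i < a + j, α i = β i)
    (q : Fin a → Fin m → F) (c : Fin n) : hankelOut α q j c = hankelOut β q j c := by
  refine Finset.sum_congr rfl fun i _ => ?_
  rw [h (i + j) (by have := i.2; omega)]

theorem HankelNonsingular.congr {α β : ℕ → Fin m → Fin n → F} {t : ℕ}
    (hα : HankelNonsingular α t) (h : ∀ i < (m + n) * t, α i = β i) : HankelNonsingular β t := by
  have : hankelMap β (n * t) (m * t) = hankelMap α (n * t) (m * t) := by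
    refine LinearMap.ext fun q => ?_
    ext j c
    refine (hankelOut_congr (fun i hi => h i ?_) q c).symm
    have := j.2
    rw [add_mul]
    omega
  rwa [HankelNonsingular, this]

theorem hankelMap_surjective_mono {α : ℕ → Fin m → Fin n → F} {a b a' b' : ℕ} (ha : a ≤ a')
    (hb : b' ≤ b) (h : Function.Surjective (hankelMap α a b)) :
    Function.Surjective (hankelMap α a' b') := by
  induction a', ha using Nat.le_induction with
  | base =>
    intro y
    obtain ⟨q, hq⟩ := h (fun j => if hj : (j : ℕ) < b' then y ⟨j, hj⟩ else 0)
    refine ⟨q, ?_⟩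
    ext j c
    have := congrFun (congrFun hq ⟨j, j.2.trans_le hb⟩) c
    simpa [hankelMap] using this
  | succ a' _ ih =>
    intro y
    obtain ⟨q, hq⟩ := ih y
    refine ⟨Fin.snoc q 0, ?_⟩
    rw [← hq]
    ext j c
    exact hankelOut_snoc_zero α q j c

theorem HankelNonsingular.surjective {α : ℕ → Fin m → Fin n → F} {t a b : ℕ}
    (h : HankelNonsingular α t) (ha : n * t ≤ a) (hb : b ≤ m * t) :
    Function.Surjective (hankelMap α a b) := by
  refine hankelMap_surjective_mono ha hb ((LinearMap.injective_iff_surjective_of_finrank_eq_finrank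
    ?_).mp h)
  simp [Module.finrank_pi_fintype]
  ring

/-- A vector of polynomials with vanishing coefficients in the top degree. -/
theorem exists_eq_snoc_zero {a : ℕ} {q : Fin (a + 1) → Fin m → F} (h : q (Fin.last a) = 0) :
    q = Fin.snoc (Fin.init q) 0 := by
  rw [← h, Fin.snoc_init_self]

section Count

theorem ncard_hankelMap_ker {α : ℕ → Fin m → Fin n → F} {a b : ℕ}
    (h : Function.Surjective (hankelMap α a b)) :
    {q | hankelMap α a b q = 0}.ncard = Nat.card F ^ (m * a - n * b) := by
  have h1 : {q | hankelMap α a b q = 0}.ncard = Nat.card (LinearMap.ker (hankelMap α a b)) := rfl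
  rw [h1, Module.natCard_eq_pow_finrank (K := F)]
  have h2 := LinearMap.finrank_range_add_finrank_ker (hankelMap α a b)
  rw [LinearMap.range_eq_top.mpr h, finrank_top] at h2
  simp [Module.finrank_pi_fintype] at h2
  congr 1
  rw [mul_comm m a, mul_comm n b]
  omega

variable [Finite F]

/-- The polynomial vectors of degree exactly `a` in the kernel of a Hankel matrix. -/
def hankelTop (α : ℕ → Fin m → Fin n → F) (a b : ℕ) : Set (Fin (a + 1) → Fin m → F) :=
  {q | hankelMap α (a + 1) b q = 0 ∧ q (Fin.last a) ≠ 0}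

/-- A kernel vector of degree at most `a` either has a nonzero top coefficient or is a kernel vector
of degree below `a` padded with zero. -/
theorem ncard_hankelTop {α : ℕ → Fin m → Fin n → F} {a b : ℕ}
    (h : Function.Surjective (hankelMap α a b)) :
    (hankelTop α a b).ncard + Nat.card F ^ (m * a - n * b) =
      Nat.card F ^ (m * (a + 1) - n * b) := by
  rw [← ncard_hankelMap_ker (hankelMap_surjective_mono (Nat.le_succ a) le_rfl h),
    ← ncard_hankelMap_ker h]
  have hinj : Function.Injective
      (fun q : Fin a → Fin m → F => (Fin.snoc q 0 : Fin (a + 1) → Fin m → F)) := by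
    intro q q' hq
    exact (Fin.snoc_inj.mp hq).1
  rw [← Set.ncard_image_of_injective _ hinj, ← Set.ncard_union_eq]
  · congr 1
    ext q
    simp only [hankelTop, Set.mem_union, Set.mem_ofPred_eq, Set.mem_image]
    constructor
    · rintro (⟨hq, -⟩ | ⟨q, hq, rfl⟩)
      · exact hq
      · rw [hankelMap_eq_zero_iff] at hq ⊢
        intro j hj c
        rw [hankelOut_snoc_zero]
        exact hq j hj c
    · intro hq
      by_cases h0 : q (Fin.last a) = 0
      · right
        refine ⟨Fin.init q, ?_, (exists_eq_snoc_zero h0).symm⟩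
        rw [exists_eq_snoc_zero h0] at hq
        rw [hankelMap_eq_zero_iff] at hq ⊢
        intro j hj c
        rw [← hankelOut_snoc_zero]
        exact hq j hj c
      · exact Or.inl ⟨hq, h0⟩
  · rw [Set.disjoint_left]
    rintro q ⟨-, hq⟩ ⟨q', -, rfl⟩
    simp at hq

end Count

end Hankel

/-! ### Extending digit sequences -/

section Extend

variable {F : Type*} [Field F] {m n : ℕ}

/-- Keep the first `T` terms of `α`, continue with the `L` terms of `β`, then with zeros. -/
def extendDigits (α : ℕ → Fin m → Fin n → F) (T : ℕ) {L : ℕ} (β : Fin L × Fin m × Fin n → F) :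
    ℕ → Fin m → Fin n → F :=
  fun i l c => if i < T then α i l c else if h : i - T < L then β (⟨i - T, h⟩, l, c) else 0

theorem extendDigits_of_lt (α : ℕ → Fin m → Fin n → F) {T L i : ℕ} (β : Fin L × Fin m × Fin n → F)
    (h : i < T) : extendDigits α T β i = α i := by
  ext l c
  simp [extendDigits, h]

theorem extendDigits_injective (α : ℕ → Fin m → Fin n → F) (T : ℕ) {L : ℕ}
    {β β' : Fin L × Fin m × Fin n → F}
    (h : ∀ i < T + L, extendDigits α T β i = extendDigits α T β' i) : β = β' := by
  ext ⟨i, l, c⟩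
  have := congrFun (congrFun (h (T + i) (by have := i.2; omega)) l) c
  simpa [extendDigits] using this

/-- The extensions of a digit sequence for which a given polynomial vector is in the kernel of the
Hankel matrix: each column past the known digits imposes `n` conditions. -/
theorem ncard_extension_le [Finite F] (α : ℕ → Fin m → Fin n → F) {T L a b B : ℕ}
    (hT : T ≤ a + b) (hL : a + B ≤ T + L) {q : Fin (a + 1) → Fin m → F} (hq : q (Fin.last a) ≠ 0) :
    {β : Fin L × Fin m × Fin n → F |
      ∀ j < B, ∀ c, hankelOut (extendDigits α T β) q j c = 0}.ncard ≤
        Nat.card F ^ (L * (m * n) - n * (B - b)) := by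
  classical
  obtain ⟨l₀, hl₀⟩ : ∃ l₀, q (Fin.last a) l₀ ≠ 0 := by
    by_contra! h
    exact hq (funext h)
  -- The last digit in equation `j` has index `a + j` and meets only the leading coefficient of `q`.
  -- Its entry in row `l₀`, where that coefficient is nonzero, is therefore determined by the other
  -- entries; `e` lists these positions for `b ≤ j < B`.
  let e : Fin (B - b) × Fin n → Fin L × Fin m × Fin n := fun p =>
    (⟨a + b + p.1 - T, by have := p.1.2; omega⟩, l₀, p.2)
  have he : Function.Injective e := by
    rintro ⟨j, c⟩ ⟨j', c'⟩ h
    simp only [e, Prod.mk.injEq, Fin.mk.injEq, true_and] at h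
    refine Prod.ext (Fin.ext ?_) h.2
    have := h.1
    simp only
    omega
  have hcard : (Finset.univ.image e).card = n * (B - b) := by
    rw [Finset.card_image_of_injective _ he]
    simp [mul_comm]
  have hι : Fintype.card (Fin L × Fin m × Fin n) = L * (m * n) := by simp
  rw [← hcard, ← hι]
  refine ncard_le_of_determined _ _ fun β hβ β' hβ' hoff => ?_
  have hoff' : ∀ i l c, ¬ (l = l₀ ∧ a + b ≤ i ∧ i < a + B) →
      extendDigits α T β i l c = extendDigits α T β' i l c := by
    intro i l c h
    unfold extendDigits
    split_ifs with h1 h2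
    · rfl
    · refine hoff _ fun hmem => h ?_
      simp only [Finset.mem_image, Finset.mem_univ, true_and, e, Prod.mk.injEq, Fin.mk.injEq,
        Prod.exists] at hmem
      obtain ⟨j, c', hj, hl, -⟩ := hmem
      refine ⟨hl.symm, ?_, ?_⟩
      · omega
      · have := j.2
        omega
    · rfl
  refine extendDigits_injective α T fun i _ => ?_
  induction i using Nat.strong_induction_on with
  | _ i ih =>
    ext l c
    by_cases h : l = l₀ ∧ a + b ≤ i ∧ i < a + B
    · obtain ⟨rfl, h1, h2⟩ := h
      obtain ⟨j, rfl⟩ : ∃ j, i = a + j := ⟨i - a, by omega⟩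
      have hj : j < B := by omega
      have e1 := hβ j hj c
      rw [← hβ' j hj c, ← Fin.snoc_init_self q, hankelOut_snoc, hankelOut_snoc,
        hankelOut_congr (fun i hi => ih i hi (by omega)), add_right_inj,
        ← Finset.add_sum_erase _ _ (Finset.mem_univ l),
        ← Finset.add_sum_erase _ _ (Finset.mem_univ l)] at e1
      have e2 : ∀ x ∈ Finset.univ.erase l,
          q (Fin.last a) x * extendDigits α T β (a + j) x c =
            q (Fin.last a) x * extendDigits α T β' (a + j) x c := by
        intro x hx
        rw [hoff']
        intro h
        exact Finset.ne_of_mem_erase hx h.1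
      rw [Finset.sum_congr rfl e2, add_left_inj] at e1
      exact mul_left_cancel₀ hl₀ e1
    · exact hoff' i l c h

/-- A nonzero vector in the kernel of a singular Hankel matrix, of minimal degree. -/
theorem exists_minimal_of_not_injective {α : ℕ → Fin m → Fin n → F} {A b : ℕ}
    (h : ¬ Function.Injective (hankelMap α A b)) :
    ∃ a < A, ∃ q ∈ hankelTop α a b, ∀ a' < a, hankelTop α a' b = ∅ := by
  have key : ∀ A, ¬ Function.Injective (hankelMap α A b) → ∃ a < A, (hankelTop α a b).Nonempty := by
    intro A
    induction A with
    | zero =>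
      intro h
      exact absurd (fun q q' _ => Subsingleton.elim q q') h
    | succ A ih =>
      intro h
      by_cases h' : Function.Injective (hankelMap α A b)
      · refine ⟨A, Nat.lt_succ_self A, ?_⟩
        rw [injective_iff_map_eq_zero] at h h'
        push Not at h
        obtain ⟨q, hq, hq0⟩ := h
        refine ⟨q, hq, fun hlast => hq0 ?_⟩
        rw [exists_eq_snoc_zero hlast] at hq
        have : Fin.init q = 0 := by
          refine h' _ ?_
          rw [hankelMap_eq_zero_iff] at hq ⊢
          intro j hj c
          rw [← hankelOut_snoc_zero]
          exact hq j hj c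
        rw [exists_eq_snoc_zero hlast, this]
        ext i l
        refine Fin.lastCases ?_ (fun i => ?_) i <;> simp
      · obtain ⟨a, ha, hq⟩ := ih h'
        exact ⟨a, ha.trans (Nat.lt_succ_self A), hq⟩
  classical
  have hex := key A h
  have hex' : ∃ a, (hankelTop α a b).Nonempty := ⟨hex.choose, hex.choose_spec.2⟩
  obtain ⟨a, ha, hne⟩ := hex
  obtain ⟨q, hq⟩ := Nat.find_spec hex'
  refine ⟨Nat.find hex', (Nat.find_min' hex' hne).trans_lt ha, q, hq, fun a' ha' => ?_⟩
  exact Set.not_nonempty_iff_eq_empty.mp (Nat.find_min hex' ha')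

theorem HankelNonsingular.hankelTop_eq_empty {α : ℕ → Fin m → Fin n → F} {t a b : ℕ}
    (h : HankelNonsingular α t) (ha : a < n * t) (hb : m * t ≤ b) : hankelTop α a b = ∅ := by
  -- Padding with zero top coefficients passes injectivity down to smaller degrees.
  have hinj : ∀ d, a + 1 ≤ d → Function.Injective (hankelMap α d (m * t)) →
      Function.Injective (hankelMap α (a + 1) (m * t)) := by
    intro d hd
    induction d, hd using Nat.le_induction with
    | base => exact id
    | succ d _ ih =>
      intro h
      refine ih ?_
      rw [injective_iff_map_eq_zero] at h ⊢
      intro q hq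
      have : (Fin.snoc q 0 : Fin (d + 1) → Fin m → F) = 0 := by
        refine h _ ?_
        rw [hankelMap_eq_zero_iff] at hq ⊢
        intro j hj c
        rw [hankelOut_snoc_zero]
        exact hq j hj c
      ext i l
      have := congrFun (congrFun this i.castSucc) l
      simpa using this
  rw [Set.eq_empty_iff_forall_notMem]
  rintro q ⟨hq, hlast⟩
  refine hlast ?_
  have hq0 : q = 0 := by
    refine (injective_iff_map_eq_zero _).mp (hinj _ ha h) q ?_
    rw [hankelMap_eq_zero_iff] at hq ⊢
    exact fun j hj c => hq j (hj.trans_le hb) c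
  rw [hq0]
  rfl

end Extend

/-! ### Counting nonsingular extensions -/

section Step

variable {F : Type*} [Field F] {m n : ℕ}

/-- The vectors of `hankelTop α (n * t + s) (m * t - s)` that are not `X` times a vector of the same
kind for `s - 1`. -/
def primitiveTop (α : ℕ → Fin m → Fin n → F) (t : ℕ) :
    (s : ℕ) → Set (Fin (n * t + s + 1) → Fin m → F)
  | 0 => hankelTop α (n * t) (m * t)
  | s + 1 => hankelTop α (n * t + (s + 1)) (m * t - (s + 1)) \
      (fun q => Fin.cons 0 q) '' hankelTop α (n * t + s) (m * t - s)

/-- The witness is a kernel vector of minimal degree. Nonsingularity at `t` forces its degree to be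
at least `n * t`, and its equations with `j < m * t - s` involve only old digits. Minimality makes
it primitive. -/
theorem HankelNonsingular.exists_of_not_extend {α : ℕ → Fin m → Fin n → F} {t N : ℕ}
    (hα : HankelNonsingular α t) {β : Fin ((m + n) * N) × Fin m × Fin n → F}
    (hβ : ¬ HankelNonsingular (extendDigits α ((m + n) * t) β) (t + N)) :
    ∃ s < n * N, ∃ q ∈ hankelTop α (n * t + s) (m * t - s),
      (∀ j < m * (t + N), ∀ c, hankelOut (extendDigits α ((m + n) * t) β) q j c = 0) ∧
      (s < m * t → q ∈ primitiveTop α t s) := by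
  obtain ⟨a, ha, q, ⟨hq, hlast⟩, hmin⟩ := exists_minimal_of_not_injective hβ
  have hα' : HankelNonsingular (extendDigits α ((m + n) * t) β) t :=
    hα.congr fun i hi => (extendDigits_of_lt α β hi).symm
  have hta : n * t ≤ a := by
    by_contra! hlt
    have := hα'.hankelTop_eq_empty hlt (Nat.mul_le_mul_left m (Nat.le_add_right t N))
    exact Set.eq_empty_iff_forall_notMem.mp this q ⟨hq, hlast⟩
  obtain ⟨s, rfl⟩ := Nat.exists_eq_add_of_le hta
  rw [hankelMap_eq_zero_iff] at hq
  have hdm : (m + n) * t = m * t + n * t := add_mul _ _ _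
  have hqα : q ∈ hankelTop α (n * t + s) (m * t - s) := by
    refine ⟨?_, hlast⟩
    rw [hankelMap_eq_zero_iff]
    intro j hj c
    rw [← hq j (by rw [mul_add]; omega) c]
    exact hankelOut_congr (fun i hi => (extendDigits_of_lt α β (by omega)).symm) q c
  refine ⟨s, ?_, q, hqα, hq, fun hs => ?_⟩
  · rw [mul_add] at ha
    omega
  cases s with
  | zero => exact hqα
  | succ s =>
    refine ⟨hqα, ?_⟩
    rintro ⟨q', ⟨hq', hlast'⟩, rfl⟩
    -- If `q = X q'`, the equations for `q` are those for `q'` shifted by one. The missing equation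
    -- `j = 0` for `q'` already holds through the old digits, so `q'` would be a kernel vector of
    -- smaller degree.
    refine Set.eq_empty_iff_forall_notMem.mp (hmin (n * t + s) (by omega)) q' ⟨?_, hlast'⟩
    rw [hankelMap_eq_zero_iff] at hq' ⊢
    intro j hj c
    cases j with
    | zero =>
      rw [← hq' 0 (by omega) c]
      exact hankelOut_congr (fun i hi => extendDigits_of_lt α β (by omega)) q' c
    | succ j =>
      rw [← hankelOut_cons]
      exact hq j (by omega) c

theorem hankelNonsingular_zero (α : ℕ → Fin m → Fin n → F) : HankelNonsingular α 0 := by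
  intro q q' _
  ext i
  exact absurd i.2 (by simp)

variable [Finite F]

/-- The union bound for the extensions of `α` whose Hankel matrix is singular. -/
theorem ncard_not_extend_le {α : ℕ → Fin m → Fin n → F} {t N : ℕ}
    (C : (s : ℕ) → Set (Fin (n * t + s + 1) → Fin m → F))
    (hC : ∀ s < n * N, C s ⊆ hankelTop α (n * t + s) (m * t - s))
    (hcover : ∀ β : Fin ((m + n) * N) × Fin m × Fin n → F,
      ¬ HankelNonsingular (extendDigits α ((m + n) * t) β) (t + N) → ∃ s < n * N, ∃ q ∈ C s,
        ∀ j < m * (t + N), ∀ c, hankelOut (extendDigits α ((m + n) * t) β) q j c = 0) :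
    {β : Fin ((m + n) * N) × Fin m × Fin n → F |
      ¬ HankelNonsingular (extendDigits α ((m + n) * t) β) (t + N)}.ncard ≤
      ∑ s ∈ Finset.range (n * N), (C s).ncard *
        Nat.card F ^ ((m + n) * N * (m * n) - n * (m * (t + N) - (m * t - s))) := by
  classical
  have hfin : ∀ s, (C s).Finite := fun s => Set.toFinite _
  let Sol : (s : ℕ) → (Fin (n * t + s + 1) → Fin m → F) →
      Set (Fin ((m + n) * N) × Fin m × Fin n → F) := fun s q =>
    {β | ∀ j < m * (t + N), ∀ c, hankelOut (extendDigits α ((m + n) * t) β) q j c = 0}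
  have h1 : {β : Fin ((m + n) * N) × Fin m × Fin n → F |
      ¬ HankelNonsingular (extendDigits α ((m + n) * t) β) (t + N)} ⊆
      ⋃ s ∈ Finset.range (n * N), ⋃ q ∈ (hfin s).toFinset, Sol s q := by
    intro β hβ
    obtain ⟨s, hs, q, hq, h⟩ := hcover β hβ
    simp only [Set.mem_iUnion]
    exact ⟨s, Finset.mem_range.mpr hs, q, (hfin s).mem_toFinset.mpr hq, h⟩
  refine (Set.ncard_le_ncard h1 (Set.toFinite _)).trans
    ((Finset.set_ncard_biUnion_le _ _).trans (Finset.sum_le_sum fun s hs => ?_))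
  rw [Finset.mem_range] at hs
  refine (Finset.set_ncard_biUnion_le _ _).trans ?_
  rw [Set.ncard_eq_toFinset_card _ (hfin s)]
  refine Finset.sum_le_card_nsmul (hfin s).toFinset _ _ fun q hq => ?_
  refine ncard_extension_le α ?_ ?_ (hC s hs ((hfin s).mem_toFinset.mp hq)).2
  · rw [add_mul]
    omega
  · rw [add_mul, add_mul, mul_add]
    omega

/-- The equations on old digits are independent by surjectivity. For `s ≤ m * t` the exponent is `(m
+ n) * s`; beyond that the truncated subtraction leaves no equation. -/
theorem HankelNonsingular.ncard_hankelTop {α : ℕ → Fin m → Fin n → F} {t : ℕ}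
    (hα : HankelNonsingular α t) (s : ℕ) :
    ((hankelTop α (n * t + s) (m * t - s)).ncard : ℝ) =
      (Nat.card F : ℝ) ^ (m * (n * t + s) - n * (m * t - s)) * ((Nat.card F : ℝ) ^ m - 1) := by
  have h := _root_.ncard_hankelTop (hα.surjective (Nat.le_add_right (n * t) s)
    (Nat.sub_le (m * t) s))
  have h1 : n * (m * t - s) ≤ m * (n * t + s) :=
    (Nat.mul_le_mul_left n (Nat.sub_le _ _)).trans (by
      rw [mul_add, mul_left_comm]
      omega)
  have h2 : m * (n * t + s + 1) - n * (m * t - s) = m * (n * t + s) - n * (m * t - s) + m := by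
    rw [mul_add m _ 1]
    omega
  rw [h2, pow_add] at h
  have h3 : ((hankelTop α (n * t + s) (m * t - s)).ncard : ℝ) +
      (Nat.card F : ℝ) ^ (m * (n * t + s) - n * (m * t - s)) =
      (Nat.card F : ℝ) ^ (m * (n * t + s) - n * (m * t - s)) * (Nat.card F : ℝ) ^ m := by
    exact_mod_cast h
  linarith

theorem mul_level_le {m n N s : ℕ} (hm : 0 < m) (hs : s < n * N) :
    n * (m * N) + n * s ≤ (m + n) * N * (m * n) := by
  have h1 : n * s ≤ n * (n * N) := Nat.mul_le_mul_left n hs.le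
  calc n * (m * N) + n * s ≤ n * (m * N) + n * (n * N) := by omega
    _ = (m + n) * N * (1 * n) := by ring
    _ ≤ _ := by gcongr; exact hm

/-- The expected number of vectors of degree `n * t + s` in the kernel of a random extension. -/
theorem HankelNonsingular.ncard_hankelTop_mul (hm : 0 < m) {α : ℕ → Fin m → Fin n → F} {t N s : ℕ}
    (hα : HankelNonsingular α t) (hs : s < n * N) :
    ((hankelTop α (n * t + s) (m * t - s)).ncard : ℝ) *
        (Nat.card F : ℝ) ^ ((m + n) * N * (m * n) - n * (m * (t + N) - (m * t - s))) =
      (Nat.card F : ℝ) ^ ((m + n) * N * (m * n) - n * (m * N) + m * s) *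
        ((Nat.card F : ℝ) ^ m - 1) := by
  rw [hα.ncard_hankelTop, mul_right_comm, ← pow_add]
  congr 2
  have h0 := mul_level_le hm hs
  generalize (m + n) * N * (m * n) = D at *
  -- The `n * m * (t + N)` equations are split between the choice of `q` and the new digits, so the
  -- truncated term `m * t - s` cancels.
  have e1 : m * (n * t + s) = n * (m * t) + m * s := by ring
  have e2 : n * (m * (t + N) - (m * t - s)) = n * (m * t) + n * (m * N) - n * (m * t - s) := by
    rw [Nat.mul_sub]
    congr 1
    ring
  have e3 : n * (m * t - s) ≤ n * (m * t) := Nat.mul_le_mul_left n (Nat.sub_le _ _)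
  have e4 : n * (m * t) ≤ n * (m * t - s) + n * s := by
    rw [← mul_add]
    exact Nat.mul_le_mul_left n (by omega)
  rw [e1, e2]
  omega

theorem one_lt_natCard_real : (1 : ℝ) < Nat.card F := by
  exact_mod_cast Finite.one_lt_card (α := F)

/-- Multiplication by `X` embeds level `s` into level `s + 1`, which is `k^(m+n)` times larger;
removing the image leaves the proportion `1 - k^(-(m+n))`. -/
theorem HankelNonsingular.ncard_primitiveTop_mul (hm : 0 < m) {α : ℕ → Fin m → Fin n → F}
    {t N s : ℕ} (hα : HankelNonsingular α t) (hs : s + 1 < n * N) (hst : s + 1 ≤ m * t) :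
    ((primitiveTop α t (s + 1)).ncard : ℝ) *
        (Nat.card F : ℝ) ^ ((m + n) * N * (m * n) - n * (m * (t + N) - (m * t - (s + 1)))) =
      (Nat.card F : ℝ) ^ ((m + n) * N * (m * n) - n * (m * N) + m * (s + 1)) *
        ((Nat.card F : ℝ) ^ m - 1) * (1 - ((Nat.card F : ℝ) ^ (m + n))⁻¹) := by
  have hk : (Nat.card F : ℝ) ≠ 0 := by
    have := one_lt_natCard_real (F := F)
    positivity
  have hinj : Function.Injective (fun q : Fin (n * t + s + 1) → Fin m → F =>
      (Fin.cons 0 q : Fin (n * t + (s + 1) + 1) → Fin m → F)) := fun q q' h =>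
    (Fin.cons_inj.mp h).2
  have hsub : (fun q : Fin (n * t + s + 1) → Fin m → F =>
      (Fin.cons 0 q : Fin (n * t + (s + 1) + 1) → Fin m → F)) ''
        hankelTop α (n * t + s) (m * t - s) ⊆ hankelTop α (n * t + (s + 1)) (m * t - (s + 1)) := by
    rintro _ ⟨q, ⟨hq, hlast⟩, rfl⟩
    refine ⟨?_, hlast⟩
    rw [hankelMap_eq_zero_iff] at hq ⊢
    intro j hj c
    exact (hankelOut_cons α q j c).trans (hq (j + 1) (by omega) c)
  have hcard : ((primitiveTop α t (s + 1)).ncard : ℝ) =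
      (hankelTop α (n * t + (s + 1)) (m * t - (s + 1))).ncard -
        (hankelTop α (n * t + s) (m * t - s)).ncard := by
    rw [eq_sub_iff_add_eq, ← Set.ncard_image_of_injective _ hinj]
    exact_mod_cast Set.ncard_sdiff_add_ncard_of_subset hsub (Set.toFinite _)
  have h1 := hα.ncard_hankelTop_mul hm hs
  have h0 := hα.ncard_hankelTop_mul (N := N) hm (s := s) (by omega)
  have e : (m + n) * N * (m * n) - n * (m * (t + N) - (m * t - s)) =
      ((m + n) * N * (m * n) - n * (m * (t + N) - (m * t - (s + 1)))) + n := by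
    have h2 := mul_level_le hm hs
    have h3 : m * (t + N) - (m * t - (s + 1)) = m * N + (s + 1) := by
      rw [mul_add]
      omega
    have h4 : m * (t + N) - (m * t - s) = m * N + s := by
      rw [mul_add]
      omega
    rw [h3, h4]
    simp only [mul_add, mul_one] at h2 ⊢
    omega
  rw [e, pow_add, ← mul_assoc] at h0
  rw [hcard, sub_mul, h1, eq_div_of_mul_eq (pow_ne_zero n hk) h0]
  rw [mul_add m s 1, mul_one, ← add_assoc, pow_add _ _ m, pow_add _ m n]
  field_simp

/-- The sum telescopes. Level `0` lacks the factor `1 - k^(-(m+n))`, but `k^m - 1 ≤ k^m - k^(-n) =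
k^m (1 - k^(-(m+n)))` makes up for it. -/
theorem sum_levels_le {k : ℝ} (hk : 1 ≤ k) {m n : ℕ} {f : ℕ → ℝ} (A : ℝ) (hA : 0 ≤ A) {J : ℕ}
    (h0 : f 0 ≤ A * (k ^ m - 1))
    (hs : ∀ s, s + 1 < J → f (s + 1) ≤ A * k ^ (m * (s + 1)) * (k ^ m - 1) *
      (1 - (k ^ (m + n))⁻¹)) (hJ : 0 < J) :
    ∑ s ∈ Finset.range J, f s ≤ A * k ^ (m * J) * (1 - (k ^ (m + n))⁻¹) := by
  have hk0 : 0 < k := by linarith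
  induction J, hJ using Nat.le_induction with
  | base =>
    rw [Finset.sum_range_one, mul_assoc]
    refine h0.trans (mul_le_mul_of_nonneg_left ?_ hA)
    rw [Nat.succ_eq_add_one, zero_add, mul_one, mul_sub, mul_one, pow_add, mul_inv, ← mul_assoc,
      mul_inv_cancel₀ (pow_ne_zero m hk0.ne'), one_mul]
    have : (k ^ n)⁻¹ ≤ 1 := inv_le_one_of_one_le₀ (one_le_pow₀ hk)
    linarith
  | succ J hJ ih =>
    rw [Finset.sum_range_succ]
    obtain ⟨J, rfl⟩ : ∃ J', J = J' + 1 := ⟨J - 1, by omega⟩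
    have h1 := ih fun s h => hs s (by omega)
    have h2 := hs J (by omega)
    refine (add_le_add h1 h2).trans (le_of_eq ?_)
    rw [mul_add m (J + 1) 1, mul_one, pow_add]
    ring

/-- A definite proportion of the extensions of a nonsingular digit sequence is nonsingular. -/
theorem HankelNonsingular.le_ncard_extend (hm : 0 < m) (hn : 0 < n) {α : ℕ → Fin m → Fin n → F}
    {t N : ℕ} (hα : HankelNonsingular α t) (hN : 0 < N) (ht : n * N ≤ m * t) :
    Nat.card F ^ ((m + n) * N * (m * n) - (m + n)) ≤
      {β : Fin ((m + n) * N) × Fin m × Fin n → F |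
        HankelNonsingular (extendDigits α ((m + n) * t) β) (t + N)}.ncard := by
  have hk := one_lt_natCard_real (F := F)
  have hsub : ∀ s, primitiveTop α t s ⊆ hankelTop α (n * t + s) (m * t - s) := by
    rintro (_ | s)
    · exact subset_rfl
    · exact Set.sdiff_subset
  have h1 := ncard_not_extend_le (N := N) (primitiveTop α t) (fun s _ => hsub s) fun β hβ => by
    obtain ⟨s, hs, q, -, hq, hp⟩ := hα.exists_of_not_extend hβ
    -- Here `ht` gives `s < n * N ≤ m * t`, so primitivity is available at every level.
    exact ⟨s, hs, q, hp (by omega), hq⟩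
  have hnN : 0 < n * N := Nat.mul_pos hn hN
  have hlevel : n * (m * N) ≤ (m + n) * N * (m * n) :=
    (Nat.le_add_right _ _).trans (mul_level_le hm hnN)
  have h2 : (∑ s ∈ Finset.range (n * N), ((primitiveTop α t s).ncard *
      Nat.card F ^ ((m + n) * N * (m * n) - n * (m * (t + N) - (m * t - s))) : ℝ)) ≤
      (Nat.card F : ℝ) ^ ((m + n) * N * (m * n) - n * (m * N)) * (Nat.card F : ℝ) ^ (m * (n * N)) *
        (1 - ((Nat.card F : ℝ) ^ (m + n))⁻¹) := by
    refine sum_levels_le hk.le _ (by positivity) ?_ (fun s hs => ?_) hnN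
    · exact (hα.ncard_hankelTop_mul hm hnN).le
    · rw [hα.ncard_primitiveTop_mul hm hs (by omega), pow_add]
  rw [← pow_add, mul_left_comm m n N, Nat.sub_add_cancel hlevel] at h2
  have h3 : {β : Fin ((m + n) * N) × Fin m × Fin n → F |
      HankelNonsingular (extendDigits α ((m + n) * t) β) (t + N)}.ncard +
      {β : Fin ((m + n) * N) × Fin m × Fin n → F |
        ¬ HankelNonsingular (extendDigits α ((m + n) * t) β) (t + N)}.ncard =
      Nat.card F ^ ((m + n) * N * (m * n)) := by
    rw [show {β : Fin ((m + n) * N) × Fin m × Fin n → F |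
      ¬ HankelNonsingular (extendDigits α ((m + n) * t) β) (t + N)} = {β |
        HankelNonsingular (extendDigits α ((m + n) * t) β) (t + N)}ᶜ from rfl,
      Set.ncard_add_ncard_compl, Nat.card_fun]
    simp
  have hle : m + n ≤ (m + n) * N * (m * n) := by
    rw [mul_assoc]
    exact Nat.le_mul_of_pos_right _ (by positivity)
  have h4 : (Nat.card F : ℝ) ^ ((m + n) * N * (m * n) - (m + n)) =
      (Nat.card F : ℝ) ^ ((m + n) * N * (m * n)) * ((Nat.card F : ℝ) ^ (m + n))⁻¹ := by
    rw [pow_sub₀ _ (by positivity) hle]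
  rify at h1 h3 ⊢
  rw [h4]
  linarith

/-- Some extension of a nonsingular digit sequence is nonsingular. -/
theorem HankelNonsingular.exists_extend (hm : 0 < m) {α : ℕ → Fin m → Fin n → F}
    {t : ℕ} (hα : HankelNonsingular α t) (N : ℕ) :
    ∃ β : Fin ((m + n) * N) × Fin m × Fin n → F,
      HankelNonsingular (extendDigits α ((m + n) * t) β) (t + N) := by
  have hk := one_lt_natCard_real (F := F)
  by_contra! hbad
  have h1 := ncard_not_extend_le (N := N) _ (fun s _ => subset_rfl) fun β hβ => by
    obtain ⟨s, hs, q, hq, h, -⟩ := hα.exists_of_not_extend hβ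
    exact ⟨s, hs, q, hq, h⟩
  have h0 : {β : Fin ((m + n) * N) × Fin m × Fin n → F |
      ¬ HankelNonsingular (extendDigits α ((m + n) * t) β) (t + N)} = Set.univ :=
    Set.eq_univ_of_forall hbad
  rw [h0, Set.ncard_univ, Nat.card_fun] at h1
  rify at h1
  rw [Finset.sum_congr rfl fun s hs =>
    hα.ncard_hankelTop_mul hm (Finset.mem_range.mp hs)] at h1
  have hlevel : n * (m * N) ≤ (m + n) * N * (m * n) := by
    calc n * (m * N) = m * N * (1 * n) := by ring
      _ ≤ (m + n) * N * (m * n) := by gcongr <;> omega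
  -- The geometric sum falls short of the number of all extensions by a positive power of `k`.
  have h2 : ∑ s ∈ Finset.range (n * N), (Nat.card F : ℝ) ^
      ((m + n) * N * (m * n) - n * (m * N) + m * s) * ((Nat.card F : ℝ) ^ m - 1) =
      (Nat.card F : ℝ) ^ ((m + n) * N * (m * n) - n * (m * N)) *
        ((Nat.card F : ℝ) ^ (m * (n * N)) - 1) := by
    simp only [pow_add, mul_assoc _ _ ((Nat.card F : ℝ) ^ m - 1)]
    rw [← Finset.mul_sum, ← Finset.sum_mul]
    simp only [pow_mul _ m]
    rw [geom_sum_mul]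
  rw [h2, mul_sub, ← pow_add, mul_left_comm m n N, Nat.sub_add_cancel hlevel] at h1
  have h3 : 0 < (Nat.card F : ℝ) ^ ((m + n) * N * (m * n) - n * (m * N)) := by positivity
  have h4 : Nat.card (Fin ((m + n) * N) × Fin m × Fin n) = (m + n) * N * (m * n) := by simp
  rw [h4] at h1
  linarith

end Step

/-! ### Coefficients and norms of Laurent series -/

namespace InvLaurentSeries

variable {F : Type*} [Field F]

/-- The coefficient of `X⁻ⁱ`. -/
def coeff (i : ℤ) : InvLaurentSeries F →+ F where
  toFun x := HahnSeries.coeff (show LaurentSeries F from x) i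
  map_zero' := rfl
  map_add' _ _ := rfl

/-- The monomial `a X⁻ⁱ`. -/
noncomputable def monomial (i : ℤ) (a : F) : InvLaurentSeries F := (HahnSeries.single i a : LaurentSeries F)

theorem coeff_monomial (i j : ℤ) (a : F) : coeff j (monomial i a) = if j = i then a else 0 := by
  classical
  refine Eq.trans HahnSeries.coeff_single ?_
  split_ifs <;> rfl

theorem coeff_monomial_mul (i j : ℤ) (a : F) (y : InvLaurentSeries F) :
    coeff (j + i) (monomial i a * y) = a * coeff j y :=
  HahnSeries.coeff_single_mul_add (r := a) (x := (show LaurentSeries F from y)) (a := j) (b := i)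

theorem X_pow_eq_monomial (i : ℕ) : (X : InvLaurentSeries F) ^ i = monomial (-(i : ℤ)) 1 := by
  refine (HahnSeries.single_pow (R := F) (-1 : ℤ) i 1).trans ?_
  rw [monomial]
  simp

theorem algebraMap_eq_monomial (a : F) : algebraMap F (InvLaurentSeries F) a = monomial 0 a :=
  (HahnSeries.algebraMap_apply' (R := F) (Γ := ℤ) (x := a)).trans
    (HahnSeries.ofPowerSeries_C (Γ := ℤ) a)

theorem smul_monomial (i : ℤ) (a b : F) : a • monomial i b = monomial i (a * b) := by
  rw [Algebra.smul_def, algebraMap_eq_monomial]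
  refine HahnSeries.ext (funext fun j => ?_)
  have h1 := coeff_monomial_mul 0 j a (monomial i b)
  rw [add_zero, coeff_monomial, mul_ite, mul_zero] at h1
  exact h1.trans (coeff_monomial i j (a * b)).symm

theorem aeval_X_eq_sum (p : F[X]) {a : ℕ} (ha : p.natDegree < a) :
    Polynomial.aeval (X : InvLaurentSeries F) p =
      ∑ i ∈ Finset.range a, monomial (-(i : ℤ)) (p.coeff i) := by
  rw [Polynomial.aeval_eq_sum_range' ha]
  refine Finset.sum_congr rfl fun i _ => ?_
  rw [X_pow_eq_monomial, smul_monomial, mul_one]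

theorem coeff_aeval_mul (p : F[X]) {a : ℕ} (ha : p.natDegree < a) (y : InvLaurentSeries F) (j : ℤ) :
    coeff j (Polynomial.aeval (X : InvLaurentSeries F) p * y) =
      ∑ i ∈ Finset.range a, p.coeff i * coeff (i + j) y := by
  rw [aeval_X_eq_sum p ha, Finset.sum_mul, map_sum]
  refine Finset.sum_congr rfl fun i _ => ?_
  rw [← coeff_monomial_mul (-(i : ℤ)), show (i : ℤ) + j + -(i : ℤ) = j by ring]

theorem coeff_aeval (p : F[X]) (j : ℤ) :
    coeff j (Polynomial.aeval (X : InvLaurentSeries F) p) =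
      if j ≤ 0 then p.coeff (-j).toNat else 0 := by
  rw [aeval_X_eq_sum p (Nat.lt_succ_self _), map_sum]
  simp only [coeff_monomial]
  split_ifs with hj
  · obtain ⟨d, rfl⟩ : ∃ d : ℕ, j = -(d : ℤ) := ⟨(-j).toNat, by omega⟩
    simp only [neg_inj, Nat.cast_inj, neg_neg, Int.toNat_natCast, Finset.sum_ite_eq,
      Finset.mem_range]
    split_ifs with hd
    · rfl
    · exact (Polynomial.coeff_eq_zero_of_natDegree_lt (by omega)).symm
  · refine Finset.sum_eq_zero fun i _ => if_neg ?_
    omega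

section Norm

variable [Finite F]

theorem norm_of_ne_zero {x : InvLaurentSeries F} (hx : x ≠ 0) :
    ‖x‖ = (Nat.card F : ℝ) ^ (-x.order) := if_neg hx

theorem zpow_le_norm {x : InvLaurentSeries F} {i : ℤ} (h : coeff i x ≠ 0) :
    (Nat.card F : ℝ) ^ (-i) ≤ ‖x‖ := by
  have hx : x ≠ 0 := by
    rintro rfl
    exact h (map_zero _)
  rw [norm_of_ne_zero hx]
  exact zpow_le_zpow_right₀ (one_lt_natCard_real (F := F)).le
    (neg_le_neg (HahnSeries.order_le_of_coeff_ne_zero h))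

theorem norm_le_zpow {x : InvLaurentSeries F} {j : ℤ} (h : ∀ i < j, coeff i x = 0) :
    ‖x‖ ≤ (Nat.card F : ℝ) ^ (-j) := by
  by_cases hx : x = 0
  · rw [hx, norm_zero]
    positivity
  rw [norm_of_ne_zero hx]
  refine zpow_le_zpow_right₀ (one_lt_natCard_real (F := F)).le (neg_le_neg ?_)
  by_contra! hlt
  exact HahnSeries.coeff_order_eq_zero.not.mpr hx (h _ hlt)

theorem exists_degree_ofPolyVec {h : ℕ} {q : Fin h → F[X]} (hq : q ≠ 0) :
    ∃ D : ℕ, (∀ l, (q l).natDegree ≤ D) ∧ (Nat.card F : ℝ) ^ D ≤ ‖ofPolyVec q‖ := by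
  classical
  obtain ⟨l₀, hl₀⟩ : ∃ l, q l ≠ 0 := by
    by_contra! h
    exact hq (funext h)
  obtain ⟨l, hl, hmax⟩ := Finset.exists_max_image (Finset.univ.filter fun l => q l ≠ 0)
    (fun l => (q l).natDegree) ⟨l₀, by simp [hl₀]⟩
  refine ⟨(q l).natDegree, fun l' => ?_, ?_⟩
  · by_cases h0 : q l' = 0
    · simp [h0]
    · exact hmax l' (by simp [h0])
  · refine le_trans ?_ (norm_le_pi_norm (ofPolyVec q) l)
    have h1 := zpow_le_norm (x := ofPolyVec q l) (i := -((q l).natDegree : ℤ)) (by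
      rw [ofPolyVec, coeff_aeval]
      simpa using hl)
    simpa using h1

/-- Subtracting a polynomial does not change the coefficients at negative powers of `X`. -/
theorem le_latticeDist {h : ℕ} {x : Fin h → InvLaurentSeries F} {b j : ℕ} {c : Fin h} (hj : j < b)
    (hx : coeff (j + 1) (x c) ≠ 0) : (Nat.card F : ℝ) ^ (-(b : ℤ)) ≤ latticeDist x := by
  refine le_ciInf fun p => ?_
  refine le_trans ?_ (norm_le_pi_norm (x - ofPolyVec p) c)
  have h1 : coeff ((j : ℤ) + 1) ((x - ofPolyVec p) c) ≠ 0 := by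
    rw [Pi.sub_apply, map_sub, ofPolyVec, coeff_aeval, if_neg (by omega), sub_zero]
    exact hx
  refine le_trans ?_ (zpow_le_norm h1)
  exact zpow_le_zpow_right₀ (one_lt_natCard_real (F := F)).le (by omega)

end Norm

/-- The series `∑ f i X^{-(i+1)}`. -/
noncomputable def ofDigitSeq (f : ℕ → F) : InvLaurentSeries F :=
  HahnSeries.ofPowerSeries ℤ F (PowerSeries.X * PowerSeries.mk f)

theorem coeff_ofDigitSeq (f : ℕ → F) (i : ℕ) : coeff (i + 1) (ofDigitSeq f) = f i := by
  have := HahnSeries.ofPowerSeries_apply_coeff (Γ := ℤ) (PowerSeries.X * PowerSeries.mk f) (i + 1)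
  rw [PowerSeries.coeff_succ_X_mul, PowerSeries.coeff_mk] at this
  exact_mod_cast this

end InvLaurentSeries

/-! ### From Hankel matrices to bad approximability -/

section DigitMatrix

open InvLaurentSeries

variable {F : Type*} [Field F] {m n : ℕ}

/-- The matrix over `𝓛` whose coefficient of `X^{-(i+1)}` is `α i`. -/
noncomputable def digitMatrix (α : ℕ → Fin m → Fin n → F) : Matrix (Fin m) (Fin n) (InvLaurentSeries F) :=
  fun l c => ofDigitSeq fun i => α i l c

theorem coeff_vecMul_digitMatrix (α : ℕ → Fin m → Fin n → F) {q : Fin m → F[X]} {a : ℕ}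
    (hq : ∀ l, (q l).natDegree < a) (j : ℕ) (c : Fin n) :
    InvLaurentSeries.coeff (j + 1) ((ofPolyVec q ᵥ* digitMatrix α) c) =
      hankelOut α (fun (i : Fin a) l => (q l).coeff i) j c := by
  rw [Matrix.vecMul, dotProduct, map_sum, hankelOut, Finset.sum_comm]
  refine Finset.sum_congr rfl fun l _ => ?_
  rw [ofPolyVec, coeff_aeval_mul (q l) (hq l), Finset.sum_range]
  refine Finset.sum_congr rfl fun i _ => ?_
  rw [digitMatrix, ← coeff_ofDigitSeq (fun i => α i l c)]
  push_cast
  rw [add_assoc]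

variable [Finite F]

theorem digitMatrix_mem_badlyApproximable (hn : 0 < n) {α : ℕ → Fin m → Fin n → F} {t N : ℕ}
    (hN : 0 < N) (hα : ∀ j, HankelNonsingular α (t + N * j)) :
    digitMatrix α ∈ badlyApproximable F m n := by
  have hk := one_lt_natCard_real (F := F)
  have hk0 : (Nat.card F : ℝ) ≠ 0 := by positivity
  -- The term `n * m * (t + N)` is the loss in rounding the degree of `q` up to `n * T` with `T` in
  -- the progression; the `+ 1` makes the inequality strict.
  refine ⟨(Nat.card F : ℝ) ^ (-((n * m * (t + N) + 1 : ℕ) : ℤ)), by positivity, fun q hq => ?_⟩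
  obtain ⟨D, hD, hqD⟩ := exists_degree_ofPolyVec hq
  obtain ⟨T, hT, hT', hαT⟩ : ∃ T, D < n * T ∧ n * T ≤ D + n * (t + N) ∧ HankelNonsingular α T := by
    refine ⟨t + N * (D / (n * N) + 1), ?_, ?_, hα _⟩
    · have := Nat.lt_mul_div_succ D (Nat.mul_pos hn hN)
      calc D < n * N * (D / (n * N) + 1) := this
        _ = n * (N * (D / (n * N) + 1)) := by ring
        _ ≤ _ := Nat.mul_le_mul_left n (Nat.le_add_left _ _)
    · have := Nat.mul_div_le D (n * N)
      calc n * (t + N * (D / (n * N) + 1)) = n * N * (D / (n * N)) + n * (t + N) := by ring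
        _ ≤ _ := by omega
  have hdist : (Nat.card F : ℝ) ^ (-((m * T : ℕ) : ℤ)) ≤
      latticeDist (ofPolyVec q ᵥ* digitMatrix α) := by
    by_contra! hlt
    refine hq ?_
    have hv : (fun (i : Fin (n * T)) l => (q l).coeff i) = (0 : Fin (n * T) → Fin m → F) := by
      refine (injective_iff_map_eq_zero _).mp hαT _ ?_
      rw [hankelMap_eq_zero_iff]
      intro j hj c
      by_contra hne
      rw [← coeff_vecMul_digitMatrix α (fun l => (hD l).trans_lt hT)] at hne
      exact hlt.not_ge (le_latticeDist hj hne)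
    ext l i
    by_cases hi : i < n * T
    · exact congrFun (congrFun hv ⟨i, hi⟩) l
    · exact Polynomial.coeff_eq_zero_of_natDegree_lt (by have := hD l; omega)
  calc (Nat.card F : ℝ) ^ (-((n * m * (t + N) + 1 : ℕ) : ℤ)) / ‖ofPolyVec q‖ ^ m
      ≤ (Nat.card F : ℝ) ^ (-((n * m * (t + N) + 1 : ℕ) : ℤ)) / ((Nat.card F : ℝ) ^ D) ^ m := by
        gcongr
    _ = (Nat.card F : ℝ) ^ (-((n * m * (t + N) + 1 : ℕ) : ℤ) - ((D * m : ℕ) : ℤ)) := by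
        rw [zpow_sub₀ hk0, zpow_natCast, pow_mul]
    _ < (Nat.card F : ℝ) ^ (-((m * T : ℕ) : ℤ) * n) := by
        refine zpow_lt_zpow_right₀ hk ?_
        have := Nat.mul_le_mul_left m hT'
        zify at this
        push_cast
        nlinarith
    _ = ((Nat.card F : ℝ) ^ (-((m * T : ℕ) : ℤ))) ^ n := by
        rw [zpow_mul, zpow_natCast]
    _ ≤ _ := by gcongr

/-- Digit sequences that differ at index `i` give matrices at distance at least `k^{-(i+1)}`. -/
theorem le_dist_digitMatrix {α β : ℕ → Fin m → Fin n → F} {i : ℕ} (h : α i ≠ β i) :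
    (Nat.card F : ℝ) ^ (-((i + 1 : ℕ) : ℤ)) ≤ dist (digitMatrix α) (digitMatrix β) := by
  obtain ⟨l, c, hlc⟩ : ∃ l c, α i l c ≠ β i l c := by
    by_contra! h'
    exact h (funext fun l => funext fun c => h' l c)
  rw [dist_eq_norm]
  refine le_trans ?_ (Matrix.norm_entry_le_entrywise_sup_norm _ (i := l) (j := c))
  push_cast
  refine zpow_le_norm ?_
  rw [Matrix.sub_apply, map_sub, digitMatrix, digitMatrix, coeff_ofDigitSeq, coeff_ofDigitSeq]
  exact sub_ne_zero.mpr hlc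

end DigitMatrix

/-! ### Cantor sets of nonsingular digit sequences -/

section Dimension

open scoped NNReal ENNReal

/-- A set containing a regular Cantor set with `M` children per node, separated at scale
`M^{-j/r}` on level `j`, has Hausdorff dimension at least `r`. -/
theorem le_dimH_of_separated {Y : Type*} [MetricSpace Y] {S : Set Y} {M : ℕ} (hM : 1 < M)
    (g : (ℕ → Fin M) → Y) (hg : ∀ u, g u ∈ S) {r C : ℝ≥0} (hr : 0 < r)
    (h : ∀ u v j, (∀ i < j, u i = v i) → u j ≠ v j →
      ((M : ℝ) ^ j)⁻¹ ≤ C * dist (g u) (g v) ^ (r : ℝ)) :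
    (r : ℝ≥0∞) ≤ dimH S := by
  have hM0 : (0 : ℝ) < M := by positivity
  have hfirst : ∀ u v : ℕ → Fin M, u ≠ v → ∃ j, (∀ i < j, u i = v i) ∧ u j ≠ v j := by
    intro u v huv
    have hex : ∃ j, u j ≠ v j := Function.ne_iff.mp huv
    classical
    exact ⟨Nat.find hex, fun i hi => not_not.mp (Nat.find_min hex hi), Nat.find_spec hex⟩
  have hinj : Function.Injective g := by
    intro u v huv
    by_contra hne
    obtain ⟨j, hj, hj'⟩ := hfirst u v hne
    have := h u v j hj hj'
    rw [huv, dist_self, Real.zero_rpow (by positivity), mul_zero] at this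
    have : (0 : ℝ) < ((M : ℝ) ^ j)⁻¹ := by positivity
    linarith
  have : NeZero M := ⟨by omega⟩
  have hleft : ∀ u, Function.invFun g (g u) = u := Function.leftInverse_invFun hinj
  -- Reading the address of a point as base-`M` digits maps the Cantor set onto `[0, 1]`, and the
  -- separation says that this map is `r`-Hölder.
  have hhol : HolderOnWith C r (fun y => Real.ofDigits (Function.invFun g y)) (Set.range g) := by
    rintro _ ⟨u, rfl⟩ _ ⟨v, rfl⟩
    simp only [hleft]
    by_cases huv : u = v
    · simp [huv]
    obtain ⟨j, hj, hj'⟩ := hfirst u v huv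
    rw [edist_dist, edist_dist, ENNReal.ofReal_rpow_of_nonneg dist_nonneg r.coe_nonneg,
      ← ENNReal.ofReal_coe_nnreal, ← ENNReal.ofReal_mul C.coe_nonneg]
    refine ENNReal.ofReal_le_ofReal ?_
    rw [Real.dist_eq]
    exact (Real.abs_ofDigits_sub_ofDigits_le hj).trans (h u v j hj hj')
  have himage : Set.Icc (0 : ℝ) 1 ⊆
      (fun y => Real.ofDigits (Function.invFun g y)) '' Set.range g := by
    intro x hx
    obtain ⟨u, -, rfl⟩ := Real.ofDigits_SurjOn hM hx
    exact ⟨g u, ⟨u, rfl⟩, by simp only [hleft]⟩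
  have h1 : (1 : ℝ≥0∞) ≤ dimH (Set.range g) / r := by
    calc (1 : ℝ≥0∞) = dimH (Set.Icc (0 : ℝ) 1) := by
          rw [Real.dimH_of_nonempty_interior (by simp [interior_Icc]), Module.finrank_self,
            Nat.cast_one]
      _ ≤ _ := dimH_mono himage
      _ ≤ _ := hhol.dimH_image_le hr
  have hr0 : (r : ℝ≥0∞) ≠ 0 := by exact_mod_cast hr.ne'
  rw [ENNReal.le_div_iff_mul_le (Or.inl hr0) (Or.inl ENNReal.coe_ne_top), one_mul] at h1
  exact h1.trans (dimH_mono (Set.range_subset_iff.mpr hg))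

variable {F : Type*} [Field F] {m n : ℕ}

/-- Successive extensions of `α` by blocks of digits; `ext j β x` is the block appended to `β` at
stage `j` for the choice `x`. -/
def iterateExtend {ι : Type*} {N t : ℕ} (α : ℕ → Fin m → Fin n → F)
    (ext : ℕ → (ℕ → Fin m → Fin n → F) → ι → Fin ((m + n) * N) × Fin m × Fin n → F) (u : ℕ → ι) :
    ℕ → ℕ → Fin m → Fin n → F
  | 0 => α
  | j + 1 => extendDigits (iterateExtend (t := t) α ext u j) ((m + n) * (t + N * j))
      (ext j (iterateExtend (t := t) α ext u j) (u j))

theorem HankelNonsingular.exists_children [Finite F] (hm : 0 < m) (hn : 0 < n)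
    {α : ℕ → Fin m → Fin n → F} {t N : ℕ} (hα : HankelNonsingular α t) (hN : 0 < N)
    (ht : n * N ≤ m * t) :
    ∃ c : Fin (Nat.card F ^ ((m + n) * N * (m * n) - (m + n))) →
        Fin ((m + n) * N) × Fin m × Fin n → F,
      Function.Injective c ∧
        ∀ x, HankelNonsingular (extendDigits α ((m + n) * t) (c x)) (t + N) := by
  have h := hα.le_ncard_extend hm hn hN ht
  rw [← Nat.card_coe_set_eq] at h
  refine ⟨fun x => ((Finite.equivFin _).symm (Fin.castLE h x)).1, ?_, fun x =>
    ((Finite.equivFin _).symm (Fin.castLE h x)).2⟩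
  exact Subtype.val_injective.comp ((Equiv.injective _).comp (Fin.castLE_injective h))

theorem exists_tree [Finite F] (hm : 0 < m) (hn : 0 < n) {α : ℕ → Fin m → Fin n → F} {t N : ℕ}
    (hα : HankelNonsingular α t) (hN : 0 < N) (ht : n * N ≤ m * t) :
    ∃ g : (ℕ → Fin (Nat.card F ^ ((m + n) * N * (m * n) - (m + n)))) → ℕ → Fin m → Fin n → F,
      (∀ u j, HankelNonsingular (g u) (t + N * j)) ∧
      ∀ u v j, (∀ i < j, u i = v i) → u j ≠ v j →
        ∃ i < (m + n) * (t + N * (j + 1)), g u i ≠ g v i := by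
  have hex : ∀ (j : ℕ) (β : ℕ → Fin m → Fin n → F),
      ∃ c : Fin (Nat.card F ^ ((m + n) * N * (m * n) - (m + n))) →
        Fin ((m + n) * N) × Fin m × Fin n → F, HankelNonsingular β (t + N * j) →
      Function.Injective c ∧ ∀ x,
        HankelNonsingular (extendDigits β ((m + n) * (t + N * j)) (c x)) (t + N * (j + 1)) := by
    intro j β
    by_cases hβ : HankelNonsingular β (t + N * j)
    · obtain ⟨c, hc, hc'⟩ := hβ.exists_children hm hn hN
        (ht.trans (Nat.mul_le_mul_left m (Nat.le_add_right _ _)))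
      exact ⟨c, fun _ => ⟨hc, by simpa only [mul_add, mul_one, add_assoc] using hc'⟩⟩
    -- A junk value for singular `β`, which never occurs in the tree.
    · exact ⟨fun _ _ => 0, fun h => absurd h hβ⟩
  choose ext hext using hex
  let A := iterateExtend (t := t) α ext
  have hA : ∀ u j, HankelNonsingular (A u j) (t + N * j) := by
    intro u j
    induction j with
    | zero => exact hα
    | succ j ih => exact (hext j _ ih).2 (u j)
  have hstable : ∀ u j j', j ≤ j' → ∀ i < (m + n) * (t + N * j), A u j' i = A u j i := by
    intro u j j' hj i hi
    induction j', hj using Nat.le_induction with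
    | base => rfl
    | succ j' hj' ih =>
      rw [← ih]
      refine extendDigits_of_lt _ _ (hi.trans_le ?_)
      gcongr
  -- The limit of the stages: digit `i` is settled by stage `i + 1`, since each stage fixes at least
  -- one more digit.
  let g := fun (u : ℕ → Fin (Nat.card F ^ ((m + n) * N * (m * n) - (m + n)))) (i : ℕ) =>
    A u (i + 1) i
  have hg : ∀ u j, ∀ i < (m + n) * (t + N * j), g u i = A u j i := by
    intro u j i hi
    rcases le_total (i + 1) j with h | h
    · refine (hstable u _ _ h i ?_).symm
      calc i < 1 * (0 + 1 * (i + 1)) := by omega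
        _ ≤ (m + n) * (t + N * (i + 1)) := by gcongr <;> omega
    · exact hstable u _ _ h i hi
  refine ⟨g, fun u j => (hA u j).congr fun i hi => (hg u j i hi).symm, fun u v j huv hj => ?_⟩
  by_contra! heq
  -- Equal choices before `j` lead to the same node, whose children are distinct blocks.
  have hsame : ∀ j' ≤ j, A u j' = A v j' := by
    intro j' hj'
    induction j' with
    | zero => rfl
    | succ j' ih =>
      have e := ih (by omega)
      change extendDigits (A u j') _ (ext j' (A u j') (u j')) =
        extendDigits (A v j') _ (ext j' (A v j') (v j'))
      rw [e, huv j' (by omega)]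
  have e := hsame j le_rfl
  refine hj ((hext j _ (hA u j)).1 (extendDigits_injective (A u j) ((m + n) * (t + N * j))
    fun i hi => ?_))
  have hi' : i < (m + n) * (t + N * (j + 1)) := by
    calc i < _ := hi
      _ = _ := by ring
  have h1 := heq i hi'
  rw [hg u (j + 1) i hi', hg v (j + 1) i hi'] at h1
  refine h1.trans ?_
  change extendDigits (A v j) _ (ext j (A v j) (v j)) i = _
  rw [← e]

end Dimension

/-! ### Lower and upper bounds for the dimension -/

section Bounds

open InvLaurentSeries

open scoped NNReal ENNReal
open Filter

variable {F : Type*} [Field F] [Finite F] {m n : ℕ}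

theorem sub_inv_le_dimH_badlyApproximable (hm : 0 < m) (hn : 0 < n) {N : ℕ} (hN : 2 ≤ N) :
    ((((m + n) * N * (m * n) - (m + n) : ℕ) / ((m + n) * N : ℕ) : ℝ≥0) : ℝ≥0∞) ≤
      dimH (badlyApproximable F m n) := by
  have hk := one_lt_natCard_real (F := F)
  have hk0 : (0 : ℝ) < Nat.card F := by positivity
  have hk1 : 1 < Nat.card F := by exact_mod_cast hk
  -- The proportional count needs `n * N ≤ m * t`. The root of the tree is therefore placed at `t =
  -- n * N`, reached from the empty Hankel matrix by the plain existence result.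
  obtain ⟨β, hβ⟩ := (hankelNonsingular_zero (F := F) (m := m) (n := n) fun _ _ _ => 0).exists_extend
    hm (n * N)
  rw [zero_add] at hβ
  obtain ⟨g, hg, hsep⟩ := exists_tree hm hn hβ (by omega : 0 < N)
    (Nat.le_mul_of_pos_left (n * N) hm)
  have hpos : 0 < (m + n) * N * (m * n) - (m + n) := by
    refine Nat.sub_pos_of_lt ?_
    calc m + n < (m + n) * 2 * (1 * 1) := by omega
      _ ≤ (m + n) * N * (m * n) := by gcongr <;> omega
  have hD : 0 < (m + n) * N := by positivity
  generalize hL : (m + n) * (n * N) = L at *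
  have hL' : ∀ j, (m + n) * (n * N + N * (j + 1)) = L + (m + n) * N * (j + 1) := by
    intro j
    rw [← hL]
    ring
  generalize (m + n) * N * (m * n) - (m + n) = e at *
  simp only [hL'] at hsep
  generalize (m + n) * N = D at *
  have hDr : (D : ℝ) * ((e / D : ℝ≥0) : ℝ) = e := by
    push_cast
    field_simp
  -- With `r = e / D`, this `C` turns `k^(-(L + D(j+1))r)` into exactly `k^(-ej)`.
  refine le_dimH_of_separated (C := (Nat.card F : ℝ≥0) ^ (L * ((e / D : ℝ≥0) : ℝ) + e))
    (Nat.one_lt_pow hpos.ne' hk1)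
    (fun u => digitMatrix (g u))
    (fun u => digitMatrix_mem_badlyApproximable hn (by omega : 0 < N) (hg u)) (by positivity) ?_
  intro u v j huv hj
  obtain ⟨i, hi, hne⟩ := hsep u v j huv hj
  have hdist : (Nat.card F : ℝ) ^ (-((L + D * (j + 1) : ℕ) : ℝ)) ≤
      dist (digitMatrix (g u)) (digitMatrix (g v)) := by
    refine le_trans ?_ (le_dist_digitMatrix hne)
    rw [← Real.rpow_intCast]
    refine Real.rpow_le_rpow_of_exponent_le hk.le ?_
    push_cast
    have : (i : ℝ) + 1 ≤ ((L + D * (j + 1) : ℕ) : ℝ) := by exact_mod_cast hi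
    push_cast at this
    linarith
  have hr0 : 0 ≤ ((e / D : ℝ≥0) : ℝ) := NNReal.coe_nonneg _
  generalize ((e / D : ℝ≥0) : ℝ) = r at *
  calc (((Nat.card F ^ e : ℕ) : ℝ) ^ j)⁻¹
      = (Nat.card F : ℝ) ^ (L * r + e) *
        ((Nat.card F : ℝ) ^ (-((L + D * (j + 1) : ℕ) : ℝ))) ^ r := by
        rw [← Real.rpow_mul hk0.le, ← Real.rpow_add hk0, Nat.cast_pow, ← pow_mul,
          ← Real.rpow_natCast, ← Real.rpow_neg hk0.le]
        congr 1
        push_cast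
        linear_combination ((j : ℝ) + 1) * hDr
    _ ≤ _ := by
        push_cast at hdist ⊢
        gcongr

theorem le_dimH_badlyApproximable (hm : 0 < m) (hn : 0 < n) :
    (m : ℝ≥0∞) * n ≤ dimH (badlyApproximable F m n) := by
  refine ENNReal.le_of_forall_pos_le_add fun ε hε _ => ?_
  obtain ⟨N, hN⟩ := exists_nat_gt (max 2 ε⁻¹)
  have hN2 : 2 ≤ N := by
    have := (le_max_left (2 : ℝ≥0) ε⁻¹).trans hN.le
    exact_mod_cast this
  refine le_trans ?_ (add_le_add_left (sub_inv_le_dimH_badlyApproximable hm hn hN2) _)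
  norm_cast
  rw [← NNReal.coe_le_coe]
  have hle : m + n ≤ (m + n) * N * (m * n) := by
    rw [mul_assoc]
    exact Nat.le_mul_of_pos_right _ (by positivity)
  have hNε : (N : ℝ)⁻¹ ≤ ε := by
    have h1 : ε⁻¹ ≤ N := (le_max_right _ _).trans hN.le
    exact_mod_cast inv_le_of_inv_le₀ hε h1
  simp only [NNReal.coe_add, NNReal.coe_div, NNReal.coe_natCast]
  push_cast [Nat.cast_sub hle]
  have h2 : (((m : ℝ) + n) * N * (m * n) - (m + n)) / ((m + n) * N) = m * n - (N : ℝ)⁻¹ := by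
    have : (m : ℝ) + n ≠ 0 := by positivity
    have : (N : ℝ) ≠ 0 := by positivity
    field_simp
  rw [h2]
  linarith

/-- A set that has arbitrarily fine finite covers with bounded sum of `d`-th powers of diameters has
Hausdorff dimension at most `d`. -/
theorem dimH_le_of_sum_ediam_le {Y : Type*} [EMetricSpace Y] {S : Set Y} {d : ℝ≥0} {C : ℝ≥0∞}
    (hC : C ≠ ∞) {ε : ℕ → ℝ≥0∞} (hε : Tendsto ε atTop (nhds 0)) {ι : ℕ → Type*}
    [∀ r, Fintype (ι r)] (T : ∀ r, ι r → Set Y) (hT : ∀ r i, Metric.ediam (T r i) ≤ ε r)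
    (hS : ∀ r, S ⊆ ⋃ i, T r i) (hsum : ∀ r, ∑ i, Metric.ediam (T r i) ^ (d : ℝ) ≤ C) :
    dimH S ≤ d := by
  let _ : MeasurableSpace Y := borel Y
  have : BorelSpace Y := ⟨rfl⟩
  refine dimH_le_of_hausdorffMeasure_ne_top (ne_top_of_le_ne_top hC ?_)
  refine (MeasureTheory.Measure.hausdorffMeasure_le_liminf_sum _ S ε hε T
    (Eventually.of_forall hT) (Eventually.of_forall hS)).trans ?_
  exact (liminf_le_liminf (Eventually.of_forall hsum)).trans (liminf_const C).le

theorem dimH_matrix_le :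
    dimH (Set.univ : Set (Matrix (Fin m) (Fin n) (InvLaurentSeries F))) ≤ (m : ℝ≥0∞) * n := by
  classical
  have := Fintype.ofFinite F
  have hk := one_lt_natCard_real (F := F)
  have hk0 : (0 : ℝ) < Nat.card F := by positivity
  -- The whole space has no finite cover by small sets, so it is cut into countably many bounded
  -- pieces. In each, prescribing the first `R + r` coefficients of every entry gives the cover.
  let S : ℕ → Set (Matrix (Fin m) (Fin n) (InvLaurentSeries F)) := fun R =>
    {A | ∀ l c, ∀ i < -(R : ℤ), coeff i (A l c) = 0}
  have hS : (Set.univ : Set (Matrix (Fin m) (Fin n) (InvLaurentSeries F))) = ⋃ R, S R := by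
    refine (Set.eq_univ_of_forall fun A => Set.mem_iUnion.mpr ?_).symm
    obtain ⟨R, hR⟩ := (Set.finite_range fun p : Fin m × Fin n =>
      (-(A p.1 p.2).order).toNat).bddAbove
    refine ⟨R, fun l c i hi => HahnSeries.coeff_eq_zero_of_lt_order ?_⟩
    have h1 : (-(A l c).order).toNat ≤ R := hR ⟨(l, c), rfl⟩
    change i < (A l c).order
    omega
  rw [hS, dimH_iUnion]
  refine iSup_le fun R => ?_
  have hcast : (m : ℝ≥0∞) * n = ((m * n : ℕ) : ℝ≥0) := by push_cast; rfl
  rw [hcast]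
  let T : (r : ℕ) → (Fin (R + r) × Fin m × Fin n → F) →
      Set (Matrix (Fin m) (Fin n) (InvLaurentSeries F)) := fun r β =>
    {A | A ∈ S R ∧ ∀ (i : Fin (R + r)) l c, coeff (-(R : ℤ) + (i : ℕ)) (A l c) = β (i, l, c)}
  have hdiam : ∀ r β, Metric.ediam (T r β) ≤ ((Nat.card F : ℝ≥0∞)⁻¹) ^ r := by
    intro r β
    refine Metric.ediam_le fun A hA B hB => ?_
    have h1 : dist A B ≤ (Nat.card F : ℝ) ^ (-(r : ℤ)) := by
      rw [dist_eq_norm, Matrix.norm_le_iff (by positivity)]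
      intro l c
      refine norm_le_zpow fun i hi => ?_
      rw [Matrix.sub_apply, map_sub]
      by_cases hiR : i < -(R : ℤ)
      · rw [hA.1 l c i hiR, hB.1 l c i hiR, sub_zero]
      · obtain ⟨d, rfl⟩ : ∃ d : ℕ, i = -(R : ℤ) + d := ⟨(i + R).toNat, by omega⟩
        exact sub_eq_zero.mpr ((hA.2 ⟨d, by omega⟩ l c).trans (hB.2 ⟨d, by omega⟩ l c).symm)
    rw [edist_dist]
    refine (ENNReal.ofReal_le_ofReal h1).trans (le_of_eq ?_)
    rw [zpow_neg, zpow_natCast, ← inv_pow, ENNReal.ofReal_pow (by positivity),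
      ENNReal.ofReal_inv_of_pos hk0, ENNReal.ofReal_natCast]
  have hk1 : (Nat.card F : ℝ≥0∞)⁻¹ < 1 := by
    rw [ENNReal.inv_lt_one]
    exact_mod_cast Finite.one_lt_card (α := F)
  refine dimH_le_of_sum_ediam_le (C := (Nat.card F : ℝ≥0∞) ^ (R * (m * n))) (by finiteness)
    (ENNReal.tendsto_pow_atTop_nhds_zero_of_lt_one hk1) T hdiam (fun r A hA => ?_) (fun r => ?_)
  · exact Set.mem_iUnion.mpr
      ⟨fun p => coeff (-(R : ℤ) + (p.1 : ℕ)) (A p.2.1 p.2.2), hA, fun _ _ _ => rfl⟩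
  · calc ∑ β, Metric.ediam (T r β) ^ (((m * n : ℕ) : ℝ≥0) : ℝ)
        ≤ ∑ _β : Fin (R + r) × Fin m × Fin n → F, ((Nat.card F : ℝ≥0∞)⁻¹) ^ (r * (m * n)) := by
          refine Finset.sum_le_sum fun β _ => ?_
          rw [NNReal.coe_natCast, ENNReal.rpow_natCast, pow_mul _ r]
          exact pow_le_pow_left' (hdiam r β) _
      _ = (Nat.card F : ℝ≥0∞) ^ (R * (m * n)) := by
          rw [Finset.sum_const, Finset.card_univ, nsmul_eq_mul, Fintype.card_fun,
            ← Nat.card_eq_fintype_card (α := F)]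
          simp only [Fintype.card_prod, Fintype.card_fin, Nat.cast_pow]
          rw [add_mul, pow_add, mul_assoc, ← mul_pow, ENNReal.mul_inv_cancel, one_pow, mul_one]
          · exact_mod_cast Nat.card_pos.ne'
          · exact ENNReal.natCast_ne_top _

end Bounds

theorem theorem1 {F : Type*} [Field F] [Finite F] (m n : ℕ) :
    dimH (badlyApproximable F m n) = (m : ENNReal) * (n : ENNReal) := by
  refine le_antisymm ((dimH_mono (Set.subset_univ _)).trans dimH_matrix_le) ?_
  -- If `m` or `n` is zero the lower bound reads `0 ≤ dimH _`.
  rcases Nat.eq_zero_or_pos m with rfl | hm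
  · simp
  rcases Nat.eq_zero_or_pos n with rfl | hn
  · simp
  exact le_dimH_badlyApproximable hm hn
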